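/- Consider simple undirected uncolored graphs with at least one vertex, and first-order formulas over the vocabulary consisting of adjacency and equality, in negation normal form. The number of quantifier alternations of a formula is the maximum, over all sequences of nested quantifiers in the formula, of the number of changes between $\exists$ and $\forall$ along the sequence. Let $\mathrm{FO}^2$ denote the formulas that use only two variables (which may be quantified repeatedly). Let $\mathcal{K}$ be any class of graphs (for example, all finite graphs, or all graphs). A class $C$ of graphs is said to be defined over $\mathcal{K}$ by a sentence $\Phi$ if, for every $G \in \mathcal{K}$, $G \in C$ if and only if $G \models \Phi$. Theorem 8. If a class $C$ of graphs is definable over $\mathcal{K}$ by an $\mathrm{FO}^2$ sentence, then it is definable over $\mathcal{K}$ by an $\mathrm{FO}^2$ sentence with at most one quantifier alternation. Consequently, the quantifier alternation hierarchy of $\mathrm{FO}^2$ over uncolored graphs collapses to its second level: for every $a \ge 1$, a class is definable over $\mathcal{K}$ by an $\mathrm{FO}^2$ sentence with at most $a$ quantifier alternations if and only if it is definable over $\mathcal{K}$ by an $\mathrm{FO}^2$ sentence with at most one quantifier alternation. -/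

import Mathlib

universe u

/-- First-order formulas over the vocabulary of (uncolored) graphs, i.e. adjacency and equality,
in negation normal form, whose variables (free or bound) are among the `k` variables
indexed by `Fin k`. A variable may be quantified repeatedly. -/
inductive GraphFormula (k : ℕ) : Type
  | eq (x y : Fin k) : GraphFormula k
  | ne (x y : Fin k) : GraphFormula k
  | adj (x y : Fin k) : GraphFormula k
  | nadj (x y : Fin k) : GraphFormula k
  | and (φ ψ : GraphFormula k) : GraphFormula k
  | or (φ ψ : GraphFormula k) : GraphFormula k
  | ex (x : Fin k) (φ : GraphFormula k) : GraphFormula k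
  | all (x : Fin k) (φ : GraphFormula k) : GraphFormula k

/-- The two kinds of quantifiers. -/
inductive QuantKind : Type
  | ex : QuantKind
  | all : QuantKind
  deriving DecidableEq

namespace GraphFormula

variable {k : ℕ}

/-- The variables with a free occurrence. -/
def freeVars : GraphFormula k → Finset (Fin k)
  | eq x y => {x, y}
  | ne x y => {x, y}
  | adj x y => {x, y}
  | nadj x y => {x, y}
  | and φ ψ => φ.freeVars ∪ ψ.freeVars
  | or φ ψ => φ.freeVars ∪ ψ.freeVars
  | ex x φ => φ.freeVars.erase x
  | all x φ => φ.freeVars.erase x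

/-- A sentence is a formula without free variables. -/
def IsSentence (φ : GraphFormula k) : Prop := φ.freeVars = ∅

/-- Tarskian semantics in a graph `G` under an assignment `v` of vertices to the variables. -/
def Realize {V : Type u} (G : SimpleGraph V) : GraphFormula k → (Fin k → V) → Prop
  | eq x y, v => v x = v y
  | ne x y, v => v x ≠ v y
  | adj x y, v => G.Adj (v x) (v y)
  | nadj x y, v => ¬ G.Adj (v x) (v y)
  | and φ ψ, v => φ.Realize G v ∧ ψ.Realize G v
  | or φ ψ, v => φ.Realize G v ∨ ψ.Realize G v
  | ex x φ, v => ∃ a : V, φ.Realize G (Function.update v x a)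
  | all x φ, v => ∀ a : V, φ.Realize G (Function.update v x a)

/-- The truth value depends only on the values of the free variables. -/
theorem realize_congr {V : Type u} (G : SimpleGraph V) (φ : GraphFormula k) :
    ∀ v w : Fin k → V, (∀ x ∈ φ.freeVars, v x = w x) → (φ.Realize G v ↔ φ.Realize G w) := by
  induction φ with
  | eq x y | ne x y | adj x y | nadj x y =>
    intro v w h
    simp only [Realize, h x (by simp [freeVars]), h y (by simp [freeVars])]
  | and φ ψ h₁ h₂ | or φ ψ h₁ h₂ =>
    intro v w h
    simp only [Realize, h₁ v w fun x hx => h x (by simp [freeVars, hx]),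
      h₂ v w fun x hx => h x (by simp [freeVars, hx])]
  | ex x φ ih =>
    intro v w h
    refine exists_congr fun a => ih _ _ fun y hy => ?_
    by_cases hyx : y = x
    · subst hyx; simp
    · simpa [hyx] using h y (by simp [freeVars, hyx, hy])
  | all x φ ih =>
    intro v w h
    refine forall_congr' fun a => ih _ _ fun y hy => ?_
    by_cases hyx : y = x
    · subst hyx; simp
    · simpa [hyx] using h y (by simp [freeVars, hyx, hy])

/-- Truth of a sentence in a graph. It is used for sentences and graphs with at least one vertex
only, where it does not matter which assignment is taken. -/
def Holds {V : Type u} (φ : GraphFormula k) (G : SimpleGraph V) : Prop :=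
  ∀ v : Fin k → V, φ.Realize G v

theorem holds_iff_realize {V : Type u} (G : SimpleGraph V) (φ : GraphFormula k)
    (hφ : φ.IsSentence) (v : Fin k → V) : φ.Holds G ↔ φ.Realize G v := by
  refine ⟨fun h => h v, fun h w => (realize_congr G φ v w ?_).1 h⟩
  intro x hx
  rw [hφ] at hx
  simp at hx

/-- The maximum number of quantifier alternations along a sequence of nested quantifiers of the
formula, when the formula stands in the scope of a quantifier of kind `q` (the innermost of those
whose scope it is in), or in the scope of no quantifier (`none`). -/
def alternationsBelow : Option QuantKind → GraphFormula k → ℕ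
  | _, eq _ _ => 0
  | _, ne _ _ => 0
  | _, adj _ _ => 0
  | _, nadj _ _ => 0
  | q, and φ ψ => max (alternationsBelow q φ) (alternationsBelow q ψ)
  | q, or φ ψ => max (alternationsBelow q φ) (alternationsBelow q ψ)
  | q, ex _ φ => (if q = some .all then 1 else 0) + alternationsBelow (some .ex) φ
  | q, all _ φ => (if q = some .ex then 1 else 0) + alternationsBelow (some .all) φ

/-- The number of quantifier alternations of a formula: the maximum, over all sequences of nested
quantifiers in it, of the number of changes between `∃` and `∀` along the sequence. -/
def alternations (φ : GraphFormula k) : ℕ := alternationsBelow none φ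

end GraphFormula

/-- Classes of (simple, undirected, uncolored) graphs. -/
abbrev GraphClass : Type (u + 1) := ∀ V : Type u, SimpleGraph V → Prop

/-- The sentence `φ` defines the class `C` over the graphs in `K`: a graph of `K` belongs
to `C` exactly when it satisfies `φ`. As always for first-order structures, graphs are
taken to have at least one vertex. -/
def DefinesOver {k : ℕ} (K : GraphClass.{u}) (φ : GraphFormula k) (C : GraphClass.{u}) : Prop :=
  ∀ (V : Type u) [Nonempty V] (G : SimpleGraph V), K V G → (C V G ↔ φ.Holds G)

/-- `C` is definable over `K` in first-order logic with two variables. -/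
def FO2Definable (K C : GraphClass.{u}) : Prop :=
  ∃ φ : GraphFormula 2, φ.IsSentence ∧ DefinesOver K φ C

/-- `C` is definable over `K` in first-order logic with two variables by a sentence with at most
`a` quantifier alternations. These are the levels of the alternation hierarchy (the level
with `a` alternations being the `(a + 1)`-st). -/
def FO2DefinableAlt (a : ℕ) (K C : GraphClass.{u}) : Prop :=
  ∃ φ : GraphFormula 2, φ.IsSentence ∧ φ.alternations ≤ a ∧ DefinesOver K φ C

/-!
Alternately remove from a graph the vertices adjacent to all others and the vertices adjacent to no
others, starting with either kind. A vertex that disappears in one of the first `n` rounds has its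
adjacencies determined by the rounds in which the other vertices disappear, while a vertex that
survives them has both a neighbour and a non-neighbour surviving the first `n - 1` rounds. Hence a
two-pebble game of `n` moves depends only on which pairs of removal histories up to round `n` are
realized by two equal or by two distinct vertices. Disappearing can be expressed with universal
quantifiers alone, so each of these finitely many conditions is a sentence with one alternation: two
existential quantifiers in front of formulas that are purely universal or purely existential. Every
two-variable sentence is equivalent to a Boolean combination of such sentences.
-/

universe w

/-- The dual quantifier, which replaces a quantifier when a negation is pushed through it. -/
def QuantKind.dual : QuantKind → QuantKind
  | .ex => .all
  | .all => .ex

namespace GraphFormula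

variable {k : ℕ} {V : Type u} {W : Type w}

section Negation

/-- The negation of a formula, in negation normal form. -/
def neg : GraphFormula k → GraphFormula k
  | eq x y => ne x y
  | ne x y => eq x y
  | adj x y => nadj x y
  | nadj x y => adj x y
  | and φ ψ => or φ.neg ψ.neg
  | or φ ψ => and φ.neg ψ.neg
  | ex x φ => all x φ.neg
  | all x φ => ex x φ.neg

theorem realize_neg (G : SimpleGraph V) (φ : GraphFormula k) (v : Fin k → V) :
    φ.neg.Realize G v ↔ ¬ φ.Realize G v := by
  induction φ generalizing v with
  | eq | ne | adj | nadj => simp [neg, Realize]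
  | and φ ψ hφ hψ => simp only [neg, Realize, hφ, hψ, not_and_or]
  | or φ ψ hφ hψ => simp only [neg, Realize, hφ, hψ, not_or]
  | ex x φ ih => simp only [neg, Realize, ih, not_exists]
  | all x φ ih => simp only [neg, Realize, ih, not_forall]

theorem freeVars_neg (φ : GraphFormula k) : φ.neg.freeVars = φ.freeVars := by
  induction φ <;> simp_all [neg, freeVars]

theorem IsSentence.neg {φ : GraphFormula k} (hφ : φ.IsSentence) : φ.neg.IsSentence :=
  (freeVars_neg φ).trans hφ

theorem alternationsBelow_neg (φ : GraphFormula k) (q : Option QuantKind) :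
    alternationsBelow (q.map .dual) φ.neg = alternationsBelow q φ := by
  induction φ generalizing q with
  | eq | ne | adj | nadj => simp [neg, alternationsBelow]
  | and φ ψ hφ hψ | or φ ψ hφ hψ => simp only [neg, alternationsBelow, hφ, hψ]
  | ex x φ ih | all x φ ih =>
    rcases q with _ | _ | _ <;> simp [neg, alternationsBelow, ← ih, QuantKind.dual]

theorem alternations_neg (φ : GraphFormula k) : φ.neg.alternations = φ.alternations :=
  alternationsBelow_neg φ none

theorem alternationsBelow_le_add_one (φ : GraphFormula k) (q r : Option QuantKind) :
    alternationsBelow q φ ≤ alternationsBelow r φ + 1 := by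
  induction φ with
  | eq | ne | adj | nadj => simp [alternationsBelow]
  | and | or => simp only [alternationsBelow]; omega
  | ex | all => simp only [alternationsBelow]; split_ifs <;> omega

end Negation

section Complement

/-- The formula saying in a graph what `φ` says in the complement of the graph. -/
def compl : GraphFormula k → GraphFormula k
  | eq x y => eq x y
  | ne x y => ne x y
  | adj x y => and (ne x y) (nadj x y)
  | nadj x y => or (eq x y) (adj x y)
  | and φ ψ => and φ.compl ψ.compl
  | or φ ψ => or φ.compl ψ.compl
  | ex x φ => ex x φ.compl
  | all x φ => all x φ.compl

theorem realize_compl (G : SimpleGraph V) (φ : GraphFormula k) (v : Fin k → V) :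
    φ.compl.Realize G v ↔ φ.Realize Gᶜ v := by
  induction φ generalizing v <;>
    simp_all [compl, Realize, SimpleGraph.compl_adj, imp_iff_not_or]

theorem alternationsBelow_compl (φ : GraphFormula k) (q : Option QuantKind) :
    alternationsBelow q φ.compl = alternationsBelow q φ := by
  induction φ generalizing q <;> simp_all [compl, alternationsBelow]

end Complement

section BooleanCombinations

variable [NeZero k] {ι : Type*} [Finite ι] {a : ℕ} {q : Option QuantKind}

/-- The true sentence, which serves as the empty conjunction. The language has no propositional
constants, so it has to contain a quantifier. -/
def verum : GraphFormula k := all 0 (eq 0 0)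

/-- The conjunction of a finite family of formulas. -/
noncomputable def iConj (φ : ι → GraphFormula k) : GraphFormula k :=
  let _ := Fintype.ofFinite ι
  (Finset.univ.toList.map φ).foldr and verum

theorem realize_iConj (G : SimpleGraph V) (φ : ι → GraphFormula k) (v : Fin k → V) :
    (iConj φ).Realize G v ↔ ∀ i, (φ i).Realize G v := by
  have realize_foldr (l : List (GraphFormula k)) :
      (l.foldr and verum).Realize G v ↔ ∀ φ ∈ l, φ.Realize G v := by
    induction l with
    | nil => simp [verum, Realize]
    | cons ψ l ih => simp [Realize, ih]
  simp [iConj, realize_foldr]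

theorem iConj_induction {p : GraphFormula k → Prop} {φ : ι → GraphFormula k} (verum : p verum)
    (and : ∀ φ ψ, p φ → p ψ → p (and φ ψ)) (hφ : ∀ i, p (φ i)) : p (iConj φ) :=
  List.foldrRecOn _ _ verum fun ψ hψ χ hχ => by
    obtain ⟨i, -, rfl⟩ := List.mem_map.1 hχ
    exact and _ _ (hφ i) hψ

theorem isSentence_iConj {φ : ι → GraphFormula k} (hφ : ∀ i, (φ i).IsSentence) :
    (iConj φ).IsSentence :=
  iConj_induction (p := IsSentence) (by simp [IsSentence, verum, freeVars])
    (fun φ ψ hφ hψ => by simp_all [IsSentence, freeVars]) hφ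

theorem alternationsBelow_iConj_le {φ : ι → GraphFormula k}
    (hq : alternationsBelow q (verum : GraphFormula k) ≤ a)
    (hφ : ∀ i, alternationsBelow q (φ i) ≤ a) : alternationsBelow q (iConj φ) ≤ a :=
  iConj_induction (p := (alternationsBelow q · ≤ a)) hq (fun _ _ => max_le) hφ

theorem alternationsBelow_verum_le : alternationsBelow q (verum : GraphFormula k) ≤ 1 :=
  alternationsBelow_le_add_one verum q none

/-- The disjunction of a finite family of formulas. -/
noncomputable def iDisj (φ : ι → GraphFormula k) : GraphFormula k :=
  (iConj fun i => (φ i).neg).neg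

theorem realize_iDisj (G : SimpleGraph V) (φ : ι → GraphFormula k) (v : Fin k → V) :
    (iDisj φ).Realize G v ↔ ∃ i, (φ i).Realize G v := by
  simp only [iDisj, realize_neg, realize_iConj, not_forall, not_not]

theorem isSentence_iDisj {φ : ι → GraphFormula k} (hφ : ∀ i, (φ i).IsSentence) :
    (iDisj φ).IsSentence :=
  (isSentence_iConj fun i => (hφ i).neg).neg

theorem alternations_iDisj_le {φ : ι → GraphFormula k} (hφ : ∀ i, (φ i).alternations ≤ a) :
    (iDisj φ).alternations ≤ a :=
  (alternations_neg _).trans_le <| alternationsBelow_iConj_le (Nat.zero_le a) fun i =>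
    (alternations_neg (φ i)).trans_le (hφ i)

open Classical in
/-- The formula saying that precisely the members of the family `φ` with index in `s` are true. -/
noncomputable def minterm (φ : ι → GraphFormula k) (s : Set ι) : GraphFormula k :=
  iConj fun i => if i ∈ s then φ i else (φ i).neg

theorem realize_minterm (G : SimpleGraph V) (φ : ι → GraphFormula k) (s : Set ι) (v : Fin k → V) :
    (minterm φ s).Realize G v ↔ ∀ i, i ∈ s ↔ (φ i).Realize G v := by
  rw [minterm, realize_iConj]
  refine forall_congr' fun i => ?_
  split_ifs with hi <;> simp [hi, realize_neg]

theorem isSentence_minterm {φ : ι → GraphFormula k} (hφ : ∀ i, (φ i).IsSentence) (s : Set ι) :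
    (minterm φ s).IsSentence :=
  isSentence_iConj fun i => by split_ifs; exacts [hφ i, (hφ i).neg]

theorem alternationsBelow_minterm_le {φ : ι → GraphFormula k}
    (hq : alternationsBelow q (verum : GraphFormula k) ≤ a)
    (hφ : ∀ i, alternationsBelow q (φ i) ≤ a) (hφn : ∀ i, alternationsBelow q (φ i).neg ≤ a)
    (s : Set ι) : alternationsBelow q (minterm φ s) ≤ a :=
  alternationsBelow_iConj_le hq fun i => by split_ifs; exacts [hφ i, hφn i]

theorem alternations_minterm_le {φ : ι → GraphFormula k} (hφ : ∀ i, (φ i).alternations ≤ a)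
    (s : Set ι) : (minterm φ s).alternations ≤ a :=
  alternationsBelow_minterm_le (Nat.zero_le a) hφ
    (fun i => (alternations_neg (φ i)).trans_le (hφ i)) s

theorem exists_definesOver_of_determined {K C : GraphClass.{u}} {φ : ι → GraphFormula k}
    (hφ : ∀ i, (φ i).IsSentence) (ha : ∀ i, (φ i).alternations ≤ a)
    (hC : ∀ (V W : Type u) [Nonempty V] [Nonempty W] (G : SimpleGraph V) (H : SimpleGraph W),
      K V G → K W H → (∀ i, (φ i).Holds G ↔ (φ i).Holds H) → C V G → C W H) :
    ∃ ψ : GraphFormula k, ψ.IsSentence ∧ ψ.alternations ≤ a ∧ DefinesOver K ψ C := by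
  let T : Set (Set ι) := {s | ∃ (V : Type u) (_ : Nonempty V) (G : SimpleGraph V),
    K V G ∧ C V G ∧ ∀ i, i ∈ s ↔ (φ i).Holds G}
  have hs : (iDisj fun s : T => minterm φ s.1).IsSentence :=
    isSentence_iDisj fun s => isSentence_minterm hφ s
  refine ⟨_, hs, alternations_iDisj_le fun s => alternations_minterm_le ha s,
    fun W _ H hK => ?_⟩
  have holds_iff : (iDisj fun s : T => minterm φ s.1).Holds H ↔
      ∃ s : T, ∀ i, i ∈ s.1 ↔ (φ i).Holds H := by
    let v : Fin k → W := fun _ => Classical.arbitrary W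
    simp only [holds_iff_realize H _ hs v, fun i => holds_iff_realize H _ (hφ i) v,
      realize_iDisj, realize_minterm]
  rw [holds_iff]
  constructor
  · exact fun h => ⟨⟨{i | (φ i).Holds H}, W, ‹_›, H, hK, h, fun _ => Iff.rfl⟩, fun _ => Iff.rfl⟩
  · rintro ⟨⟨s, V, _, G, hKG, hCG, hG⟩, hH⟩
    exact hC V W G H hKG hK (fun i => (hG i).symm.trans (hH i)) hCG

end BooleanCombinations

section BackAndForth

/-- The quantifier rank, i.e. the maximal number of nested quantifiers. -/
def quantifierRank : GraphFormula k → ℕ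
  | eq _ _ | ne _ _ | adj _ _ | nadj _ _ => 0
  | and φ ψ | or φ ψ => max φ.quantifierRank ψ.quantifierRank
  | ex _ φ | all _ φ => φ.quantifierRank + 1

/-- A back-and-forth system for the `k`-pebble game on `G` and `H`: if `R n v w`, then the
duplicator survives `n` more moves from the position in which the pebbles lie on `v` and `w`. -/
structure IsBackAndForth (G : SimpleGraph V) (H : SimpleGraph W)
    (R : ℕ → (Fin k → V) → (Fin k → W) → Prop) : Prop where
  eq_iff {n v w} : R n v w → ∀ i j, v i = v j ↔ w i = w j
  adj_iff {n v w} : R n v w → ∀ i j, G.Adj (v i) (v j) ↔ H.Adj (w i) (w j)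
  forth {n v w} : R (n + 1) v w →
    ∀ x a, ∃ b, R n (Function.update v x a) (Function.update w x b)
  back {n v w} : R (n + 1) v w →
    ∀ x b, ∃ a, R n (Function.update v x a) (Function.update w x b)

theorem IsBackAndForth.realize_iff {G : SimpleGraph V} {H : SimpleGraph W}
    {R : ℕ → (Fin k → V) → (Fin k → W) → Prop} (hR : IsBackAndForth G H R) (φ : GraphFormula k)
    {n : ℕ} (hn : φ.quantifierRank ≤ n) {v : Fin k → V} {w : Fin k → W} (h : R n v w) :
    φ.Realize G v ↔ φ.Realize H w := by
  induction φ generalizing n v w with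
  | eq | ne | adj | nadj => simp only [Realize, ne_eq, hR.eq_iff h, hR.adj_iff h]
  | and φ ψ hφ hψ | or φ ψ hφ hψ =>
    simp only [quantifierRank, max_le_iff] at hn
    simp only [Realize, hφ hn.1 h, hψ hn.2 h]
  | ex x φ ih =>
    obtain ⟨n, rfl⟩ := Nat.exists_eq_add_of_le' (le_of_add_le_right hn)
    have ih {v w} := @ih n (Nat.le_of_succ_le_succ hn) v w
    choose f hf using hR.forth h x
    choose g hg using hR.back h x
    exact ⟨fun ⟨a, ha⟩ => ⟨f a, (ih (hf a)).1 ha⟩, fun ⟨b, hb⟩ => ⟨g b, (ih (hg b)).2 hb⟩⟩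
  | all x φ ih =>
    obtain ⟨n, rfl⟩ := Nat.exists_eq_add_of_le' (le_of_add_le_right hn)
    have ih {v w} := @ih n (Nat.le_of_succ_le_succ hn) v w
    choose f hf using hR.forth h x
    choose g hg using hR.back h x
    exact ⟨fun hG b => (ih (hg b)).1 (hG (g b)), fun hH a => (ih (hf a)).2 (hH (f a))⟩

end BackAndForth

end GraphFormula

section Peeling

variable {V : Type u} {W : Type w} {G : SimpleGraph V} {H : SimpleGraph W}

/-- The peeling process: in each round the vertices adjacent to all remaining vertices, or those
adjacent to none of them, are removed, in alternation. `IsPeeled G k x` says that, when the last of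
`k` rounds is one for dominating vertices, `x` is removed in a round of that kind. Passing to the
complement exchanges the two kinds of rounds. A non-neighbour of `x` cannot dominate as long as `x`
remains, so that only its removal as an isolated vertex, i.e. `IsPeeled Gᶜ`, matters. -/
def IsPeeled : SimpleGraph V → ℕ → V → Prop
  | _, 0, _ => False
  | G, k + 1, x => ∀ y, Gᶜ.Adj x y → IsPeeled Gᶜ k y

theorem IsPeeled.succ {k : ℕ} {x : V} (h : IsPeeled G k x) : IsPeeled G (k + 1) x := by
  induction k generalizing G x with
  | zero => exact h.elim
  | succ k ih => exact fun y hxy => ih (h y hxy)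

theorem IsPeeled.mono {k m : ℕ} (hkm : k ≤ m) {x : V} (h : IsPeeled G k x) : IsPeeled G m x :=
  Nat.le_induction h (fun _ _ => IsPeeled.succ) m hkm

theorem IsPeeled.of_adj {k : ℕ} {x y : V} (h : IsPeeled Gᶜ k x) (hxy : G.Adj x y) :
    IsPeeled G k y := by
  cases k with
  | zero => exact h.elim
  | succ k => simpa using (h y (by simpa using hxy)).succ

theorem IsPeeled.exists_round {n : ℕ} {x : V} (h : IsPeeled G n x) :
    ∃ k < n, ¬ IsPeeled G k x ∧ IsPeeled G (k + 1) x := by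
  induction n with
  | zero => exact h.elim
  | succ n ih =>
    by_cases hn : IsPeeled G n x
    · exact (ih hn).imp fun k hk => ⟨hk.1.trans n.lt_succ_self, hk.2⟩
    · exact ⟨n, n.lt_succ_self, hn, h⟩

theorem adj_iff_not_isPeeled_compl {k : ℕ} {x y : V} (hx : ¬ IsPeeled G k x)
    (hx' : IsPeeled G (k + 1) x) (hxy : x ≠ y) : G.Adj x y ↔ ¬ IsPeeled Gᶜ k y := by
  constructor
  · exact fun hadj hy => hx (hy.of_adj hadj.symm)
  · contrapose!
    exact fun hadj => hx' y ⟨hxy, hadj⟩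

theorem exists_adj_not_isPeeled {n : ℕ} {x : V} (hx : ¬ IsPeeled G (n + 1) x)
    (hx' : ¬ IsPeeled Gᶜ (n + 1) x) :
    ∃ y, G.Adj x y ∧ ¬ IsPeeled G n y ∧ ¬ IsPeeled Gᶜ n y := by
  simp only [IsPeeled, compl_compl, not_forall] at hx'
  obtain ⟨y, hxy, hy⟩ := hx'
  exact ⟨y, hxy, hy, fun hy' => hx (hy'.of_adj hxy.symm).succ⟩

/-- Vertices of two graphs with the same removal history in the first `n` rounds. -/
def PeelSimilar (G : SimpleGraph V) (H : SimpleGraph W) (n : ℕ) (a : V) (b : W) : Prop :=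
  ∀ k ≤ n, (IsPeeled G k a ↔ IsPeeled H k b) ∧ (IsPeeled Gᶜ k a ↔ IsPeeled Hᶜ k b)

namespace PeelSimilar

variable {n : ℕ} {a a' : V} {b b' : W}

theorem symm (h : PeelSimilar G H n a b) : PeelSimilar H G n b a :=
  fun k hk => ⟨(h k hk).1.symm, (h k hk).2.symm⟩

theorem mono {m : ℕ} (hmn : m ≤ n) (h : PeelSimilar G H n a b) : PeelSimilar G H m a b :=
  fun k hk => h k (hk.trans hmn)

theorem compl (h : PeelSimilar G H n a b) : PeelSimilar Gᶜ Hᶜ n a b :=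
  fun k hk => by simpa using (h k hk).symm

theorem of_not_isPeeled (ha : ¬ IsPeeled G n a) (ha' : ¬ IsPeeled Gᶜ n a) (hb : ¬ IsPeeled H n b)
    (hb' : ¬ IsPeeled Hᶜ n b) : PeelSimilar G H n a b :=
  fun _ hk => ⟨iff_of_false (mt (.mono hk) ha) (mt (.mono hk) hb),
    iff_of_false (mt (.mono hk) ha') (mt (.mono hk) hb')⟩

theorem adj_iff_of_isPeeled (h : PeelSimilar G H (n + 1) a b) (h' : PeelSimilar G H n a' b')
    (ha : a ≠ a') (hb : b ≠ b') (hp : IsPeeled G (n + 1) a) : G.Adj a a' ↔ H.Adj b b' := by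
  obtain ⟨k, hk, hak, hak'⟩ := hp.exists_round
  rw [adj_iff_not_isPeeled_compl hak hak' ha, (h' k (by omega)).2,
    adj_iff_not_isPeeled_compl (mt (h k (by omega)).1.2 hak) ((h (k + 1) hk).1.1 hak') hb]

theorem adj_iff_of_isPeeled_or (h : PeelSimilar G H (n + 1) a b) (h' : PeelSimilar G H n a' b')
    (ha : a ≠ a') (hb : b ≠ b') (hp : IsPeeled G (n + 1) a ∨ IsPeeled G n a') :
    G.Adj a a' ↔ H.Adj b b' := by
  rcases hp with hp | hp
  · exact h.adj_iff_of_isPeeled h' ha hb hp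
  · cases n with
    | zero => exact hp.elim
    | succ n =>
      rw [G.adj_comm, H.adj_comm]
      exact h'.adj_iff_of_isPeeled (h.mono (by omega)) ha.symm hb.symm hp

end PeelSimilar

theorem adj_iff_adj_of_compl_adj_iff {a a' : V} {b b' : W} (ha : a ≠ a') (hb : b ≠ b')
    (h : Gᶜ.Adj a a' ↔ Hᶜ.Adj b b') : G.Adj a a' ↔ H.Adj b b' := by
  simpa [SimpleGraph.compl_adj, ha, hb, not_iff_not] using h

/-- Whatever removal histories up to round `n` occur in `G` at two equal vertices, or at two
distinct ones, also occur so in `H`: the duplicator's answers in `H` rely on this. -/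
def PairsEmbed (G : SimpleGraph V) (H : SimpleGraph W) (n : ℕ) : Prop :=
  ∀ a a' : V, ∃ b b' : W, (a = a' ↔ b = b') ∧ PeelSimilar G H n a b ∧ PeelSimilar G H n a' b'

namespace PairsEmbed

variable {n : ℕ} {a a' : V} {b : W}

theorem mono {m : ℕ} (hmn : m ≤ n) (h : PairsEmbed G H n) : PairsEmbed G H m := fun a a' =>
  let ⟨b, b', heq, hab, hab'⟩ := h a a'
  ⟨b, b', heq, hab.mono hmn, hab'.mono hmn⟩

theorem exists_ne_peelSimilar (h : PairsEmbed G H n) (hab : PeelSimilar G H n a b) (ha : a ≠ a') :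
    ∃ b', b ≠ b' ∧ PeelSimilar G H n a' b' := by
  obtain ⟨b₁, b₂, heq, h₁, h₂⟩ := h a a'
  by_cases hb : b = b₂
  · subst hb
    -- `a`, `a'` and `b` now have the same history, so `b₁` is a counterpart of `a'` as well.
    refine ⟨b₁, fun hb => ha (heq.2 hb.symm), fun k hk => ?_⟩
    have := hab k hk
    have := h₁ k hk
    have := h₂ k hk
    tauto
  · exact ⟨b₂, hb, h₂⟩

theorem exists_peelSimilar_adj_iff (h : PairsEmbed G H n) (hab : PeelSimilar G H (n + 1) a b)
    (ha : a ≠ a') :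
    ∃ b', b ≠ b' ∧ PeelSimilar G H n a' b' ∧ (G.Adj a a' ↔ H.Adj b b') := by
  by_cases hp : (IsPeeled G (n + 1) a ∨ IsPeeled G n a') ∨
      (IsPeeled Gᶜ (n + 1) a ∨ IsPeeled Gᶜ n a')
  · obtain ⟨b', hb, hab'⟩ := h.exists_ne_peelSimilar (hab.mono n.le_succ) ha
    refine ⟨b', hb, hab', hp.elim (hab.adj_iff_of_isPeeled_or hab' ha hb) fun hp => ?_⟩
    exact adj_iff_adj_of_compl_adj_iff ha hb
      (hab.compl.adj_iff_of_isPeeled_or hab'.compl ha hb hp)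
  · push Not at hp
    obtain ⟨⟨hpa, hpa'⟩, hpca, hpca'⟩ := hp
    have hpb := mt (hab _ le_rfl).1.2 hpa
    have hpcb := mt (hab _ le_rfl).2.2 hpca
    by_cases hadj : G.Adj a a'
    · obtain ⟨b', hbb', hpb', hpcb'⟩ := exists_adj_not_isPeeled hpb hpcb
      exact ⟨b', hbb'.ne, .of_not_isPeeled hpa' hpca' hpb' hpcb', iff_of_true hadj hbb'⟩
    · obtain ⟨b', hbb', hpcb', hpb'⟩ :=
        exists_adj_not_isPeeled hpcb ((compl_compl H).symm ▸ hpb)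
      rw [compl_compl] at hpb'
      exact ⟨b', hbb'.ne, .of_not_isPeeled hpa' hpca' hpb' hpcb', iff_of_false hadj hbb'.2⟩

end PairsEmbed

end Peeling

section TwoPebbleGame

variable {V : Type u} {W : Type w} {G : SimpleGraph V} {H : SimpleGraph W}

theorem forall_fin_two_iff (x : Fin 2) {p : Fin 2 → Prop} : (∀ i, p i) ↔ p x ∧ p (x + 1) := by
  fin_cases x <;> simp [Fin.forall_fin_two, and_comm]

/-- A position of the two-pebble game from which the duplicator survives `n` more moves by
preserving the removal histories. -/
structure IsWinningPosition (G : SimpleGraph V) (H : SimpleGraph W) (n : ℕ) (v : Fin 2 → V)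
    (w : Fin 2 → W) : Prop where
  forth : PairsEmbed G H n
  back : PairsEmbed H G n
  similar : ∀ i, PeelSimilar G H n (v i) (w i)
  eq_iff : ∀ i j, v i = v j ↔ w i = w j
  adj_iff : ∀ i j, G.Adj (v i) (v j) ↔ H.Adj (w i) (w j)

namespace IsWinningPosition

variable {n : ℕ} {v : Fin 2 → V} {w : Fin 2 → W}

theorem symm (h : IsWinningPosition G H n v w) : IsWinningPosition H G n w v where
  forth := h.back
  back := h.forth
  similar i := (h.similar i).symm
  eq_iff i j := (h.eq_iff i j).symm
  adj_iff i j := (h.adj_iff i j).symm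

theorem update (h : IsWinningPosition G H (n + 1) v w) {x : Fin 2} {a : V} {b : W}
    (hab : PeelSimilar G H n a b) (heq : v (x + 1) = a ↔ w (x + 1) = b)
    (hadj : G.Adj (v (x + 1)) a ↔ H.Adj (w (x + 1)) b) :
    IsWinningPosition G H n (Function.update v x a) (Function.update w x b) where
  forth := h.forth.mono n.le_succ
  back := h.back.mono n.le_succ
  similar := by simp [forall_fin_two_iff x, hab, (h.similar (x + 1)).mono n.le_succ]
  eq_iff := by simp [forall_fin_two_iff x, heq, eq_comm (a := a), eq_comm (a := b)]
  adj_iff := by simp [forall_fin_two_iff x, hadj, G.adj_comm a, H.adj_comm b]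

theorem exists_update (h : IsWinningPosition G H (n + 1) v w) (x : Fin 2) (a : V) :
    ∃ b, IsWinningPosition G H n (Function.update v x a) (Function.update w x b) := by
  have hsim := h.similar (x + 1)
  by_cases ha : v (x + 1) = a
  · subst ha
    exact ⟨w (x + 1), h.update (hsim.mono n.le_succ) (by simp) (by simp)⟩
  · obtain ⟨b, hb, hab, hadj⟩ :=
      (h.forth.mono n.le_succ).exists_peelSimilar_adj_iff hsim ha
    exact ⟨b, h.update hab (iff_of_false ha hb) hadj⟩

theorem isBackAndForth : GraphFormula.IsBackAndForth G H (IsWinningPosition G H) where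
  eq_iff := IsWinningPosition.eq_iff
  adj_iff := IsWinningPosition.adj_iff
  forth := exists_update
  back h x b := (h.symm.exists_update x b).imp fun _ => symm

end IsWinningPosition

theorem GraphFormula.IsSentence.holds_iff_of_pairsEmbed [Nonempty V] {φ : GraphFormula 2}
    (hφ : φ.IsSentence) (hGH : PairsEmbed G H φ.quantifierRank)
    (hHG : PairsEmbed H G φ.quantifierRank) : φ.Holds G ↔ φ.Holds H := by
  obtain ⟨a⟩ := ‹Nonempty V›
  obtain ⟨b, -, -, hab, -⟩ := hGH a a
  have hpos : IsWinningPosition G H φ.quantifierRank (fun _ => a) (fun _ => b) :=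
    ⟨hGH, hHG, fun _ => hab, by simp, by simp⟩
  rw [holds_iff_realize G φ hφ fun _ => a, holds_iff_realize H φ hφ fun _ => b]
  exact IsWinningPosition.isBackAndForth.realize_iff φ le_rfl hpos

end TwoPebbleGame

namespace GraphFormula

variable {V : Type u} {W : Type w} {G : SimpleGraph V} {H : SimpleGraph W}

/-- The formula expressing `IsPeeled`. It uses the variable other than `x` for the quantifier and
requantifies `x` in the next round. -/
def peeled : ℕ → Fin 2 → GraphFormula 2
  | 0, x => ne x x
  | k + 1, x => all (x + 1) (or (compl (nadj x (x + 1))) (peeled k (x + 1)).compl)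

theorem realize_peeled (G : SimpleGraph V) (k : ℕ) (x : Fin 2) (v : Fin 2 → V) :
    (peeled k x).Realize G v ↔ IsPeeled G k (v x) := by
  induction k generalizing G x v with
  | zero => simp [peeled, Realize, IsPeeled]
  | succ k ih => simp [peeled, Realize, IsPeeled, realize_compl, ih, imp_iff_not_or]

theorem alternationsBelow_all_peeled (k : ℕ) (x : Fin 2) :
    alternationsBelow (some .all) (peeled k x) = 0 := by
  induction k generalizing x with
  | zero => rfl
  | succ k ih => simp [peeled, alternationsBelow, alternationsBelow_compl, ih]

/-- The formulas whose truth values at a pair of vertices determine whether these are equal and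
their removal histories in the first `n` rounds; the index `false` stands for the complement. -/
def historyFormula (n : ℕ) : Option (Bool × Fin (n + 1) × Fin 2) → GraphFormula 2
  | none => eq 0 1
  | some (true, k, x) => peeled k x
  | some (false, k, x) => (peeled k x).compl

theorem alternationsBelow_all_historyFormula (n : ℕ) (i : Option (Bool × Fin (n + 1) × Fin 2)) :
    alternationsBelow (some .all) (historyFormula n i) = 0 := by
  rcases i with _ | ⟨_ | _, k, x⟩ <;>
    simp [historyFormula, alternationsBelow, alternationsBelow_compl, alternationsBelow_all_peeled]

/-- The sentence saying that there are two vertices, equal or distinct, at which precisely the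
members of `historyFormula n` with index in `s` are true. -/
noncomputable def historySentence (n : ℕ) (s : Set (Option (Bool × Fin (n + 1) × Fin 2))) :
    GraphFormula 2 :=
  ex 0 (ex 1 (minterm (historyFormula n) s))

theorem isSentence_historySentence (n : ℕ) (s : Set (Option (Bool × Fin (n + 1) × Fin 2))) :
    (historySentence n s).IsSentence := by
  simp [IsSentence, historySentence, freeVars, Finset.ext_iff, Fin.forall_fin_two]

theorem alternations_historySentence_le (n : ℕ)
    (s : Set (Option (Bool × Fin (n + 1) × Fin 2))) : (historySentence n s).alternations ≤ 1 := by
  have pos (i) : alternationsBelow (some .ex) (historyFormula n i) ≤ 1 := by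
    simpa only [alternationsBelow_all_historyFormula] using
      alternationsBelow_le_add_one (historyFormula n i) (some .ex) (some .all)
  have neg (i) : alternationsBelow (some .ex) (historyFormula n i).neg ≤ 1 :=
    calc alternationsBelow (some .ex) (historyFormula n i).neg
      _ = alternationsBelow (some .all) (historyFormula n i) :=
        alternationsBelow_neg _ (some .all)
      _ = 0 := alternationsBelow_all_historyFormula n i
      _ ≤ 1 := zero_le_one
  simpa [historySentence, alternations, alternationsBelow] using
    alternationsBelow_minterm_le alternationsBelow_verum_le pos neg s

theorem holds_historySentence_iff [Nonempty V] {n : ℕ}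
    {s : Set (Option (Bool × Fin (n + 1) × Fin 2))} :
    (historySentence n s).Holds G ↔
      ∃ v : Fin 2 → V, ∀ i, i ∈ s ↔ (historyFormula n i).Realize G v := by
  rw [holds_iff_realize G _ (isSentence_historySentence n s) fun _ => Classical.arbitrary V]
  simp only [historySentence, Realize, realize_minterm]
  constructor
  · rintro ⟨a, b, h⟩
    exact ⟨_, h⟩
  · rintro ⟨v, h⟩
    refine ⟨v 0, v 1, ?_⟩
    convert h using 4
    simp [funext_iff, Fin.forall_fin_two]

theorem pairsEmbed_of_holds_historySentence [Nonempty V] [Nonempty W] {n : ℕ}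
    (h : ∀ s, (historySentence n s).Holds G → (historySentence n s).Holds H) :
    PairsEmbed G H n := by
  intro a a'
  obtain ⟨w, hw⟩ : ∃ w : Fin 2 → W, ∀ i, (historyFormula n i).Realize G ![a, a'] ↔
      (historyFormula n i).Realize H w :=
    holds_historySentence_iff.1 <| h {i | (historyFormula n i).Realize G ![a, a']} <|
      holds_historySentence_iff.2 ⟨_, fun _ => Iff.rfl⟩
  have similar (x : Fin 2) : PeelSimilar G H n (![a, a'] x) (w x) := fun k hk => by
    have hk' := Nat.lt_succ_of_le hk
    simpa only [historyFormula, realize_compl, realize_peeled] using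
      And.intro (hw (some (true, ⟨k, hk'⟩, x))) (hw (some (false, ⟨k, hk'⟩, x)))
  exact ⟨w 0, w 1, hw none, similar 0, similar 1⟩

end GraphFormula

open GraphFormula

theorem FO2Definable.alt_one {K C : GraphClass.{u}} (h : FO2Definable K C) :
    FO2DefinableAlt 1 K C := by
  obtain ⟨φ, hφ, hC⟩ := h
  refine exists_definesOver_of_determined (isSentence_historySentence φ.quantifierRank)
    (alternations_historySentence_le φ.quantifierRank) fun V W _ _ G H hG hH hGH => ?_
  rw [hC V G hG, hC W H hH]
  exact (hφ.holds_iff_of_pairsEmbed (pairsEmbed_of_holds_historySentence fun s => (hGH s).1)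
    (pairsEmbed_of_holds_historySentence fun s => (hGH s).2)).1

theorem FO2DefinableAlt.definable {a : ℕ} {K C : GraphClass.{u}} (h : FO2DefinableAlt a K C) :
    FO2Definable K C :=
  h.imp fun _ h => ⟨h.1, h.2.2⟩

theorem FO2DefinableAlt.mono {a b : ℕ} (hab : a ≤ b) {K C : GraphClass.{u}}
    (h : FO2DefinableAlt a K C) : FO2DefinableAlt b K C :=
  h.imp fun _ h => ⟨h.1, h.2.1.trans hab, h.2.2⟩

/-- Over any class `K` of graphs (all graphs, all finite graphs, ...), every class definable in
two-variable logic is definable in it with one quantifier alternation, and so all levels of the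
alternation hierarchy from the second on coincide. -/
theorem theorem8 (K C : GraphClass.{u}) :
    (FO2Definable K C → FO2DefinableAlt 1 K C) ∧
      ∀ a : ℕ, 1 ≤ a → (FO2DefinableAlt a K C ↔ FO2DefinableAlt 1 K C) :=
  ⟨FO2Definable.alt_one, fun _ ha => ⟨fun h => h.definable.alt_one, .mono ha⟩⟩
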